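/- **Definitions.** Let $K$ be a number field and let $\mathcal{O}$ be an order of $K$, i.e. a subring of $K$ that is finitely generated as a $\mathbb{Z}$-module and has $\mathbb{Z}$-rank $[K:\mathbb{Q}]$. Let $\mathfrak{m}$ be a nonzero ideal of $\mathcal{O}$ and let $\Sigma$ be a (possibly empty) set of embeddings $K\hookrightarrow\mathbb{R}$. - Two ideals $\mathfrak{a},\mathfrak{b}$ of $\mathcal{O}$ are coprime if $\mathfrak{a}+\mathfrak{b}=\mathcal{O}$. A fractional ideal of $\mathcal{O}$ is coprime to $\mathfrak{m}$ if it is of the form $(\mathfrak{a}:\mathfrak{b})=\{x\in K: x\mathfrak{b}\subseteq\mathfrak{a}\}$ with $\mathfrak{a},\mathfrak{b}$ ideals of $\mathcal{O}$ coprime to $\mathfrak{m}$ and $\mathfrak{b}$ invertible. Let $\mathrm{J}^*_{\mathfrak{m}}(\mathcal{O})$ be the group of invertible fractional ideals of $\mathcal{O}$ coprime to $\mathfrak{m}$. - For $\alpha\in K$, write $\alpha\equiv 1 \pmod{\mathfrak{m}}$ if $\alpha=a/b$ with $a,b\in\mathcal{O}$, $b\neq 0$, $b\mathcal{O}$ coprime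 to $\mathfrak{m}$, and $a-b\in\mathfrak{m}$. Let $\mathrm{P}_{\mathfrak{m},\Sigma}(\mathcal{O})$ be the group of all $\alpha\mathcal{O}$ with $\alpha\in K^\times$, $\alpha\equiv1\pmod{\mathfrak{m}}$ and $\rho(\alpha)>0$ for all $\rho\in\Sigma$. - $\mathrm{Cl}_{\mathfrak{m},\Sigma}(\mathcal{O})=\mathrm{J}^*_{\mathfrak{m}}(\mathcal{O})/\mathrm{P}_{\mathfrak{m},\Sigma}(\mathcal{O})$ is the ray class group of $\mathcal{O}$ modulo $(\mathfrak{m},\Sigma)$, and $\mathrm{Cl}(\mathcal{O})$ is the group of all invertible fractional ideals of $\mathcal{O}$ modulo the group of all $\alpha\mathcal{O}$ with $\alpha\in K^\times$. - $\mathrm{U}_{\mathfrak{m},\Sigma}(\mathcal{O})=\{\varepsilon\in\mathcal{O}^\times : \varepsilon\equiv1\pmod{\mathfrak{m}},\ \rho(\varepsilon)>0\text{ for all }\rho\in\Sigma\}$. **Statement.** There is an exact sequence of groups $$1\to \frac{\mathcal{O}^\times}{\mathrm{U}_{\mathfrak{m},\Sigma}(\mathcal{O})}\to(\mathcal{O}/\mathfrak{m})^\times\times\{\pm1\}^{\Sigma}\to\mathrm{Cl}_{\mathfrak{m},\Sigma}(\mathcal{O})\to\mathrm{Cl}(\mathcal{O})\to1,$$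 where the first map is induced by $\varepsilon\mapsto(\varepsilon \bmod \mathfrak{m},(\operatorname{sgn}\rho(\varepsilon))_{\rho\in\Sigma})$; the second map sends $(a\bmod\mathfrak{m},(\operatorname{sgn}\rho(a))_{\rho\in\Sigma})$ to the class of $a\mathcal{O}$, for every nonzero $a\in\mathcal{O}$ with $a\mathcal{O}$ coprime to $\mathfrak{m}$; and the third map sends the class of $\mathfrak{a}\in\mathrm{J}^*_{\mathfrak{m}}(\mathcal{O})$ to the class of $\mathfrak{a}$ in $\mathrm{Cl}(\mathcal{O})$. In particular, the second map induces an isomorphism $$\frac{(\mathcal{O}/\mathfrak{m})^\times\times\{\pm1\}^{\Sigma}}{\operatorname{im}(\mathcal{O}^\times)}\;\cong\;\ker\bigl(\mathrm{Cl}_{\mathfrak{m},\Sigma}(\mathcal{O})\to\mathrm{Cl}(\mathcal{O})\bigr),$$ where $\operatorname{im}(\mathcal{O}^\times)$ is the image of $\mathcal{O}^\times$ under $\varepsilon\mapsto(\varepsilon\bmod\mathfrak{m},(\operatorname{sgn}\rho(\varepsilon))_{\rho\in\Sigma})$. -/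

import Mathlib

open scoped nonZeroDivisors

namespace RayClass

section Order

/-- `O` (a domain with a structure map `O → K`) is an order of the number field `K`: the map
`O → K` is injective, so that `O` is identified with a subring of `K`, and `O` is finitely
generated as a `ℤ`-module, of `ℤ`-rank `[K : ℚ]`. -/
class IsOrder (O K : Type*) [CommRing O] [Field K] [NumberField K] [Algebra O K] : Prop where
  injective : Function.Injective (algebraMap O K)
  finite : Module.Finite ℤ O
  finrank_eq : Module.finrank ℤ O = Module.finrank ℚ K

/-- `K` is the fraction field of each of its orders. -/
instance IsOrder.isFractionRing (O K : Type*) [CommRing O] [Field K] [NumberField K]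
    [Algebra O K] [h : IsOrder O K] : IsFractionRing O K := by
  have hfin : Module.Finite ℤ O := h.finite
  have hdom : IsDomain O := h.injective.isDomain (algebraMap O K)
  have hfaith : FaithfulSMul O K := (faithfulSMul_iff_algebraMap_injective O K).2 h.injective
  have hchar : CharZero O := charZero_of_inj_zero fun n hn => by
    have hn' := congrArg (algebraMap O K) hn
    rw [map_natCast, map_zero] at hn'
    exact_mod_cast hn'
  have hfree : Module.Free ℤ O := Module.free_of_finite_type_torsion_free'
  let b := Module.Free.chooseBasis ℤ O
  have hli : LinearIndependent ℤ (fun i => algebraMap O K (b i)) :=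
    b.linearIndependent.map' ((algebraMap O K).toAddMonoidHom.toIntLinearMap)
      (LinearMap.ker_eq_bot.2 h.injective)
  rw [LinearIndependent.iff_fractionRing ℤ ℚ] at hli
  have hcard : Fintype.card (Module.Free.ChooseBasisIndex ℤ O) = Module.finrank ℚ K := by
    rw [← h.finrank_eq, Module.finrank_eq_card_chooseBasisIndex]
  have hne : Nonempty (Module.Free.ChooseBasisIndex ℤ O) := by
    rw [← Fintype.card_pos_iff, hcard]
    exact Module.finrank_pos
  let B := basisOfLinearIndependentOfCardEqFinrank hli hcard
  refine IsFractionRing.of_field O K fun z => ?_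
  obtain ⟨d, hd⟩ := IsLocalization.exist_integer_multiples_of_finite (nonZeroDivisors ℤ)
    (fun i => B.repr z i)
  choose c hc using hd
  have hd0 : ((d : ℤ) : K) ≠ 0 := by
    exact_mod_cast nonZeroDivisors.ne_zero d.2
  refine ⟨∑ i, c i • b i, ((d : ℤ) : O), ?_⟩
  rw [map_intCast, eq_div_iff hd0, mul_comm]
  conv_lhs => rw [← B.sum_repr z]
  rw [Finset.mul_sum, map_sum]
  refine Finset.sum_congr rfl fun i _ => ?_
  have h1 : ((c i : ℤ) : ℚ) = (d : ℤ) * B.repr z i := by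
    have := hc i
    simpa [Algebra.smul_def, zsmul_eq_mul] using this
  have h2 : B i = algebraMap O K (b i) := by simp [B]
  rw [zsmul_eq_mul, map_mul, map_intCast, h2, Rat.smul_def, ← mul_assoc]
  congr 1
  have := congrArg (Rat.cast : ℚ → K) h1
  push_cast at this
  exact this.symm

end Order

section Congruence

variable {O K : Type*} [CommRing O] [IsDomain O] [Field K] [Algebra O K] [IsFractionRing O K]

/-- `α ≡ β (mod m)` for `α, β ∈ K`: one can write `α = a₁ / a₂` and `β = b₁ / b₂` with
`a₁, a₂, b₁, b₂ ∈ O`, with `a₂ O` and `b₂ O` coprime to `m`, and with `a₁ b₂ - a₂ b₁ ∈ m`. -/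
def Congr (m : Ideal O) (α β : K) : Prop :=
  ∃ a₁ a₂ b₁ b₂ : O, a₂ ≠ 0 ∧ b₂ ≠ 0 ∧ IsCoprime (Ideal.span {a₂}) m ∧
    IsCoprime (Ideal.span {b₂}) m ∧ α = algebraMap O K a₁ / algebraMap O K a₂ ∧
    β = algebraMap O K b₁ / algebraMap O K b₂ ∧
    a₁ * b₂ - a₂ * b₁ ∈ m

theorem mem_of_mul_mem_of_isCoprime {R : Type*} [CommRing R] {m : Ideal R} {x y : R}
    (hy : IsCoprime (Ideal.span {y}) m) (h : x * y ∈ m) : x ∈ m := by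
  obtain ⟨i, hi, j, hj, hij⟩ := Ideal.isCoprime_iff_exists.1 hy
  obtain ⟨t, rfl⟩ := Ideal.mem_span_singleton'.1 hi
  have hx : x = t * (x * y) + x * j := by linear_combination (-x) * hij
  rw [hx]
  exact m.add_mem (m.mul_mem_left _ h) (m.mul_mem_left _ hj)

theorem congr_one_iff {m : Ideal O} {α : K} :
    Congr m α 1 ↔ ∃ a b : O, b ≠ 0 ∧ IsCoprime (Ideal.span {b}) m ∧ α = algebraMap O K a / algebraMap O K b ∧
      a - b ∈ m := by
  constructor
  · rintro ⟨a₁, a₂, b₁, b₂, ha, hb, hca, hcb, hα, h1, hm⟩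
    refine ⟨a₁, a₂, ha, hca, hα, mem_of_mul_mem_of_isCoprime hcb ?_⟩
    have hb' : algebraMap O K b₂ ≠ 0 := by simpa using hb
    have h2 : b₁ = b₂ := by
      rw [eq_div_iff hb', one_mul] at h1
      exact (IsFractionRing.injective O K h1).symm
    rw [h2] at hm
    rwa [sub_mul]
  · rintro ⟨a, b, hb, hcb, hα, hm⟩
    refine ⟨a, b, 1, 1, hb, one_ne_zero, hcb, ?_, hα, by simp, by simpa using hm⟩
    rw [Ideal.span_singleton_one, Ideal.isCoprime_iff_sup_eq]
    exact top_sup_eq _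

theorem isCoprime_span_of_sub_mem {R : Type*} [CommRing R] {m : Ideal R} {a b : R}
    (hb : IsCoprime (Ideal.span {b}) m) (h : a - b ∈ m) : IsCoprime (Ideal.span {a}) m := by
  obtain ⟨i, hi, j, hj, hij⟩ := Ideal.isCoprime_iff_exists.1 hb
  obtain ⟨t, rfl⟩ := Ideal.mem_span_singleton'.1 hi
  refine Ideal.isCoprime_iff_exists.2 ⟨t * a, Ideal.mem_span_singleton'.2 ⟨t, rfl⟩,
    j - t * (a - b), m.sub_mem hj (m.mul_mem_left _ h), ?_⟩
  linear_combination hij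

theorem isCoprime_span_mul {R : Type*} [CommRing R] {m : Ideal R} {a b : R}
    (ha : IsCoprime (Ideal.span {a}) m) (hb : IsCoprime (Ideal.span {b}) m) :
    IsCoprime (Ideal.span {a * b}) m := by
  rw [← Ideal.span_singleton_mul_span_singleton]
  exact ha.mul_left hb

/-- The subgroup of all `α ∈ Kˣ` with `α ≡ 1 (mod m)` and `ρ(α) > 0` for all `ρ ∈ S`. -/
def raySubgroup (m : Ideal O) (S : Set (K →+* ℝ)) : Subgroup Kˣ where
  carrier := {α | Congr m (α : K) 1 ∧ ∀ ρ ∈ S, 0 < ρ (α : K)}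
  one_mem' := by
    refine ⟨congr_one_iff.2 ⟨1, 1, one_ne_zero, ?_, by simp, by simp⟩, by simp⟩
    rw [Ideal.span_singleton_one, Ideal.isCoprime_iff_sup_eq]
    exact top_sup_eq _
  mul_mem' := by
    rintro α β ⟨hα, hα'⟩ ⟨hβ, hβ'⟩
    refine ⟨?_, fun ρ hρ => by
      rw [Units.val_mul, map_mul]; exact mul_pos (hα' ρ hρ) (hβ' ρ hρ)⟩
    obtain ⟨a, b, hb, hcb, h1, hm⟩ := congr_one_iff.1 hα
    obtain ⟨c, d, hd, hcd, h2, hn⟩ := congr_one_iff.1 hβ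
    refine congr_one_iff.2 ⟨a * c, b * d, mul_ne_zero hb hd, isCoprime_span_mul hcb hcd, ?_, ?_⟩
    · rw [Units.val_mul, h1, h2, div_mul_div_comm]; simp
    · have : a * c - b * d = c * (a - b) + b * (c - d) := by ring
      rw [this]
      exact m.add_mem (m.mul_mem_left _ hm) (m.mul_mem_left _ hn)
  inv_mem' := by
    rintro α ⟨hα, hα'⟩
    refine ⟨?_, fun ρ hρ => by
      rw [Units.val_inv_eq_inv_val, map_inv₀]; exact inv_pos.2 (hα' ρ hρ)⟩
    obtain ⟨a, b, hb, hcb, h1, hm⟩ := congr_one_iff.1 hα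
    have ha : a ≠ 0 := by
      rintro rfl
      exact α.ne_zero (by rw [h1, map_zero, zero_div])
    refine congr_one_iff.2 ⟨b, a, ha, isCoprime_span_of_sub_mem hcb hm, ?_, ?_⟩
    · rw [Units.val_inv_eq_inv_val, h1, inv_div]
    · rw [← neg_sub]
      exact m.neg_mem hm

/-- The unit group `U_{m,S}(O)` of all `ε ∈ Oˣ` with `ε ≡ 1 (mod m)` and `ρ(ε) > 0` for all
`ρ ∈ S`. -/
def rayUnits (m : Ideal O) (S : Set (K →+* ℝ)) : Subgroup Oˣ where
  carrier := {ε | (ε : O) - 1 ∈ m ∧ ∀ ρ ∈ S, 0 < ρ (algebraMap O K ε)}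
  one_mem' := by simp
  mul_mem' := by
    rintro a b ⟨ha, ha'⟩ ⟨hb, hb'⟩
    refine ⟨?_, fun ρ hρ => by
      rw [Units.val_mul, map_mul, map_mul]; exact mul_pos (ha' ρ hρ) (hb' ρ hρ)⟩
    have : ((a * b : Oˣ) : O) - 1 = b * ((a : O) - 1) + ((b : O) - 1) := by
      rw [Units.val_mul]; ring
    rw [this]
    exact m.add_mem (m.mul_mem_left _ ha) hb
  inv_mem' := by
    rintro a ⟨ha, ha'⟩
    constructor
    · have : ((a⁻¹ : Oˣ) : O) - 1 = -((a⁻¹ : Oˣ) : O) * ((a : O) - 1) := by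
        linear_combination (a.inv_mul)
      rw [this]
      exact m.mul_mem_left _ ha
    · intro ρ hρ
      have h1 : ρ (algebraMap O K (a⁻¹ : Oˣ)) * ρ (algebraMap O K a) = 1 := by
        rw [← map_mul, ← map_mul, a.inv_mul, map_one, map_one]
      exact pos_of_mul_pos_left (by rw [h1]; exact one_pos) (ha' ρ hρ).le

end Congruence

section Signs

/-- The sign homomorphism `ℝˣ → {±1}`. -/
noncomputable def signUnit : ℝˣ →* ℤˣ where
  toFun x := if 0 < (x : ℝ) then 1 else -1
  map_one' := by simp
  map_mul' x y := by
    rcases lt_or_gt_of_ne x.ne_zero with hx | hx <;>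
    rcases lt_or_gt_of_ne y.ne_zero with hy | hy
    · simp [hx.not_gt, hy.not_gt, mul_pos_of_neg_of_neg hx hy]
    · simp [hx.not_gt, hy, (mul_neg_of_neg_of_pos hx hy).not_gt]
    · simp [hx, hy.not_gt, (mul_neg_of_pos_of_neg hx hy).not_gt]
    · simp [hx, hy, mul_pos hx hy]

theorem signUnit_eq_one_iff (x : ℝˣ) : signUnit x = 1 ↔ 0 < (x : ℝ) := by
  change (if 0 < (x : ℝ) then (1 : ℤˣ) else -1) = 1 ↔ _
  split_ifs with h
  · simp [h]
  · simp [h]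

/-- The map `Kˣ → {±1}^S`, `α ↦ (sgn ρ(α))_{ρ ∈ S}`. -/
noncomputable def signs {K : Type*} [Field K] (S : Set (K →+* ℝ)) : Kˣ →* (S → ℤˣ) :=
  MonoidHom.pi fun ρ => signUnit.comp (Units.map (ρ.1 : K →* ℝ))

/-- The map `Oˣ → (O/m)ˣ × {±1}^S`, `ε ↦ (ε mod m, (sgn ρ(ε))_{ρ ∈ S})`. -/
noncomputable def unitMap {O K : Type*} [CommRing O] [IsDomain O] [Field K] [Algebra O K] [IsFractionRing O K]
    (m : Ideal O) (S : Set (K →+* ℝ)) : Oˣ →* (O ⧸ m)ˣ × (S → ℤˣ) :=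
  (Units.map (Ideal.Quotient.mk m : O →* O ⧸ m)).prod
    ((signs S).comp (Units.map (algebraMap O K : O →* K)))

theorem rayUnits_le_ker_unitMap {O K : Type*} [CommRing O] [IsDomain O] [Field K] [Algebra O K] [IsFractionRing O K]
    (m : Ideal O) (S : Set (K →+* ℝ)) : rayUnits m S ≤ (unitMap m S).ker := by
  rintro ε ⟨h1, h2⟩
  rw [MonoidHom.mem_ker]
  refine Prod.ext (Units.ext ?_) (funext fun ρ => ?_)
  · exact (Ideal.Quotient.eq (I := m)).2 h1
  · exact (signUnit_eq_one_iff _).2 (h2 ρ.1 ρ.2)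

/-- The map `Oˣ / U_{m,S}(O) → (O/m)ˣ × {±1}^S` induced by
`ε ↦ (ε mod m, (sgn ρ(ε))_{ρ ∈ S})`. -/
noncomputable def unitQuotientMap {O K : Type*} [CommRing O] [IsDomain O] [Field K] [Algebra O K] [IsFractionRing O K]
    (m : Ideal O) (S : Set (K →+* ℝ)) : Oˣ ⧸ rayUnits m S →* (O ⧸ m)ˣ × (S → ℤˣ) :=
  QuotientGroup.lift _ (unitMap m S) (rayUnits_le_ker_unitMap m S)

end Signs

section RayClassGroup

variable {O K : Type*} [CommRing O] [IsDomain O] [Field K] [Algebra O K] [IsFractionRing O K]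

/-- A fractional ideal is coprime to the integral ideal `m` if it is an ideal quotient (colon
ideal) `(a : b)` of integral ideals `a`, `b` coprime to `m`, with `b` invertible. -/
def IsCoprimeTo (I : FractionalIdeal O⁰ K) (m : Ideal O) : Prop :=
  ∃ a b : Ideal O, IsCoprime a m ∧ IsCoprime b m ∧ IsUnit (b : FractionalIdeal O⁰ K) ∧
    I = (a : FractionalIdeal O⁰ K) / (b : FractionalIdeal O⁰ K)

theorem eq_div_iff_mul_eq_of_isUnit {I J L : FractionalIdeal O⁰ K} (hJ : IsUnit J) :
    L = I / J ↔ L * J = I := by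
  obtain ⟨u, rfl⟩ := hJ
  have hu : (u : FractionalIdeal O⁰ K) ≠ 0 := u.ne_zero
  have key : I / (u : FractionalIdeal O⁰ K) = I * (u⁻¹ : (FractionalIdeal O⁰ K)ˣ) := by
    apply le_antisymm
    · have h := (FractionalIdeal.le_div_iff_mul_le (J' := (u : FractionalIdeal O⁰ K)) hu).1
        (le_refl (I / (u : FractionalIdeal O⁰ K)))
      have h2 := mul_le_mul_left h ((u⁻¹ : (FractionalIdeal O⁰ K)ˣ) : FractionalIdeal O⁰ K)
      rwa [Units.mul_inv_cancel_right] at h2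
    · rw [FractionalIdeal.le_div_iff_mul_le hu, Units.inv_mul_cancel_right]
  rw [key, Units.eq_mul_inv_iff_mul_eq]

/-- The group `J*_m(O)` of invertible fractional ideals of `O` coprime to `m`. -/
def coprimeIdeals {O : Type*} (K : Type*) [CommRing O] [IsDomain O] [Field K] [Algebra O K]
    [IsFractionRing O K] (m : Ideal O) : Subgroup (FractionalIdeal O⁰ K)ˣ where
  carrier := {I | IsCoprimeTo (I : FractionalIdeal O⁰ K) m}
  one_mem' := by
    refine ⟨1, 1, isCoprime_one_left, isCoprime_one_left, ?_, ?_⟩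
    · simp
    · simp
  mul_mem' := by
    rintro I J ⟨a, b, ha, hb, hu, h⟩ ⟨c, d, hc, hd, hv, h'⟩
    rw [eq_div_iff_mul_eq_of_isUnit hu] at h
    rw [eq_div_iff_mul_eq_of_isUnit hv] at h'
    refine ⟨a * c, b * d, ha.mul_left hc, hb.mul_left hd, ?_, ?_⟩
    · rw [FractionalIdeal.coeIdeal_mul]; exact hu.mul hv
    · rw [FractionalIdeal.coeIdeal_mul, FractionalIdeal.coeIdeal_mul,
        eq_div_iff_mul_eq_of_isUnit (hu.mul hv), ← h, ← h', Units.val_mul]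
      exact mul_mul_mul_comm _ _ _ _
  inv_mem' := by
    rintro I ⟨a, b, ha, hb, hu, h⟩
    rw [eq_div_iff_mul_eq_of_isUnit hu] at h
    have hv : IsUnit (a : FractionalIdeal O⁰ K) := h ▸ I.isUnit.mul hu
    refine ⟨b, a, hb, ha, hv, ?_⟩
    rw [eq_div_iff_mul_eq_of_isUnit hv, ← h, Units.inv_mul_cancel_left]

theorem mem_coprimeIdeals_iff {m : Ideal O} {I : (FractionalIdeal O⁰ K)ˣ} :
    I ∈ coprimeIdeals K m ↔ IsCoprimeTo (I : FractionalIdeal O⁰ K) m := Iff.rfl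

/-- The group `P_{m,S}(O)` of principal ideals `α O` with `α ∈ Kˣ`, `α ≡ 1 (mod m)` and
`ρ(α) > 0` for all `ρ ∈ S`. -/
noncomputable def principalRayIdeals (m : Ideal O) (S : Set (K →+* ℝ)) :
    Subgroup (FractionalIdeal O⁰ K)ˣ :=
  (raySubgroup m S).map (toPrincipalIdeal O K)

theorem toPrincipalIdeal_mem_coprimeIdeals {m : Ideal O} {x : Kˣ} {a b : O} (hb0 : b ≠ 0)
    (ha : IsCoprime (Ideal.span {a}) m) (hb : IsCoprime (Ideal.span {b}) m)
    (hx : (x : K) = algebraMap O K a / algebraMap O K b) : toPrincipalIdeal O K x ∈ coprimeIdeals K m := by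
  have hbK : algebraMap O K b ≠ 0 := by simpa using hb0
  have hu : IsUnit ((Ideal.span {b} : Ideal O) : FractionalIdeal O⁰ K) := by
    rw [FractionalIdeal.coeIdeal_span_singleton]
    have := (toPrincipalIdeal O K (Units.mk0 (algebraMap O K b) hbK)).isUnit
    rwa [coe_toPrincipalIdeal] at this
  refine ⟨Ideal.span {a}, Ideal.span {b}, ha, hb, hu, ?_⟩
  rw [eq_div_iff_mul_eq_of_isUnit hu, coe_toPrincipalIdeal,
    FractionalIdeal.coeIdeal_span_singleton, FractionalIdeal.coeIdeal_span_singleton,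
    FractionalIdeal.spanSingleton_mul_spanSingleton, hx]
  congr 1
  exact div_mul_cancel₀ _ hbK

theorem principalRayIdeals_le_coprimeIdeals (m : Ideal O) (S : Set (K →+* ℝ)) :
    principalRayIdeals m S ≤ coprimeIdeals K m := by
  intro I hI
  obtain ⟨x, ⟨hx, -⟩, rfl⟩ := Subgroup.mem_map.1 hI
  obtain ⟨a, b, hb, hcb, h, hm⟩ := congr_one_iff.1 hx
  exact toPrincipalIdeal_mem_coprimeIdeals hb (isCoprime_span_of_sub_mem hcb hm) hcb h

/-- The ray class group `Cl_{m,S}(O) = J*_m(O) / P_{m,S}(O)`. -/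
abbrev RayClassGroup (m : Ideal O) (S : Set (K →+* ℝ)) : Type _ :=
  coprimeIdeals K m ⧸ (principalRayIdeals m S).subgroupOf (coprimeIdeals K m)

/-- The class in `Cl_{m,S}(O)` of an invertible fractional ideal coprime to `m`. -/
noncomputable def rayClass (m : Ideal O) (S : Set (K →+* ℝ)) : coprimeIdeals K m →* RayClassGroup m S :=
  QuotientGroup.mk' _

theorem subgroupOf_le_ker (m : Ideal O) (S : Set (K →+* ℝ)) :
    (principalRayIdeals m S).subgroupOf (coprimeIdeals K m) ≤
      ((ClassGroup.mk K).comp (coprimeIdeals K m).subtype).ker := by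
  rintro ⟨I, hI⟩ h
  obtain ⟨x, -, hx⟩ := Subgroup.mem_map.1 (Subgroup.mem_subgroupOf.1 h)
  replace hx : toPrincipalIdeal O K x = I := hx
  change ClassGroup.mk K I = 1
  rw [ClassGroup.mk_eq_one_iff, ← hx, coe_toPrincipalIdeal, FractionalIdeal.coe_spanSingleton]
  exact ⟨⟨x, rfl⟩⟩

/-- The change of modulus map `Cl_{m,S}(O) → Cl(O)`, sending the class of an invertible
fractional ideal coprime to `m` to its class modulo all principal fractional ideals. -/
noncomputable def toClassGroup (m : Ideal O) (S : Set (K →+* ℝ)) :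
    RayClassGroup m S →* ClassGroup O :=
  QuotientGroup.lift _ ((ClassGroup.mk K).comp (coprimeIdeals K m).subtype)
    (subgroupOf_le_ker m S)

end RayClassGroup

end RayClass

namespace RayClass

/-! ### Signs at real embeddings -/

section Signs

variable {K : Type*} [Field K]

/-! Everything rests on two ways of moving into `O`. For elements (`exists_eq_mk_and_signs_eq`):
every residue modulo `m` and every sign vector on `S` are realised together by one nonzero `a ∈ O`.
Sending the pair to the class of `a O` is then well defined and multiplicative, since two choices
differ by an element of the ray subgroup. If `a O = z O` with `z` in that subgroup, then `a / z` is
a unit of `O` with the residue and signs of `a`; this gives exactness at the product.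

For ideals, `O` need not be Dedekind, so factorisation is replaced by invertibility. A principal
ideal in `J*_m(O)` is generated by a quotient of two elements coprime to `m`
(`exists_eq_div_of_toPrincipalIdeal_mem`), which gives exactness at the ray class group. An
invertible `I` is made coprime to `m` by scaling with an element of `I⁻¹` lying outside `p I⁻¹` for
each of the finitely many maximal `p ⊇ m` (`exists_mem_forall_notMem_mul`), which gives
surjectivity. -/

theorem signs_apply_eq_one_iff {S : Set (K →+* ℝ)} {x : Kˣ} {ρ : S} :
    signs S x ρ = 1 ↔ 0 < ρ.1 (x : K) :=
  signUnit_eq_one_iff _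

theorem signs_eq_iff {S : Set (K →+* ℝ)} {x y : Kˣ} :
    signs S x = signs S y ↔ ∀ ρ ∈ S, 0 < ρ (x : K) * ρ (y : K) := by
  have hmul : ∀ ρ : S, 0 < ρ.1 (x : K) * ρ.1 (y : K) ↔ signs S x ρ = signs S y ρ := by
    intro ρ
    rw [← map_mul, ← Units.val_mul, ← signs_apply_eq_one_iff (S := S), map_mul, Pi.mul_apply,
      mul_eq_one_iff_eq_inv, Int.units_inv_eq_self]
  rw [funext_iff, Subtype.forall]
  exact forall₂_congr fun ρ hρ => (hmul ⟨ρ, hρ⟩).symm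

end Signs

/-! ### Independence of signs at the real embeddings -/

section Approximation

variable {K : Type*} [Field K] [NumberField K]

theorem finite_realEmbeddings : Finite (K →+* ℝ) :=
  Finite.of_equiv _ (RingHom.equivRatAlgHom (R := K) (S := ℝ)).symm

/-- A primitive element separates the real embeddings, so a quadratic polynomial in it can be
made negative at exactly one of them. -/
theorem exists_neg_at_unique_realEmbedding (ρ₀ : K →+* ℝ) :
    ∃ x : K, ρ₀ x < 0 ∧ ∀ ρ : K →+* ℝ, ρ ≠ ρ₀ → 0 < ρ x := by
  have := finite_realEmbeddings (K := K)
  let pb := Field.powerBasisOfFiniteOfSeparable ℚ K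
  have hsep : ∀ ρ : K →+* ℝ, ρ ≠ ρ₀ → ρ pb.gen ≠ ρ₀ pb.gen := fun ρ hρ h =>
    hρ ((RingHom.equivRatAlgHom (R := K) (S := ℝ)).injective (pb.algHom_ext h))
  have hopen : IsOpen ((fun ρ : K →+* ℝ => ρ pb.gen) '' {ρ | ρ ≠ ρ₀})ᶜ :=
    (Set.toFinite _).isClosed.isOpen_compl
  obtain ⟨ε, hε, hball⟩ := Metric.isOpen_iff.1 hopen (ρ₀ pb.gen) (by
    rintro ⟨ρ, hρ, h⟩
    exact hsep ρ hρ h)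
  -- All other real conjugates of the generator are at distance at least `ε` from `ρ₀ pb.gen`, hence
  -- outside the interval `[p, q]` around it, where `(t - p) * (t - q)` is positive.
  obtain ⟨p, hp, hp'⟩ := exists_rat_btwn (sub_lt_self (ρ₀ pb.gen) hε)
  obtain ⟨q, hq, hq'⟩ := exists_rat_btwn (lt_add_of_pos_right (ρ₀ pb.gen) hε)
  refine ⟨(pb.gen - p) * (pb.gen - q), ?_, fun ρ hρ => ?_⟩
  · simp only [map_mul, map_sub, map_ratCast]
    exact mul_neg_of_pos_of_neg (by linarith) (by linarith)
  · have hfar : ε ≤ |ρ pb.gen - ρ₀ pb.gen| := by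
      by_contra! h
      exact hball (Metric.mem_ball.2 (by rwa [Real.dist_eq])) ⟨ρ, hρ, rfl⟩
    simp only [map_mul, map_sub, map_ratCast]
    rcases le_abs.1 hfar with h | h
    · exact mul_pos (by linarith) (by linarith)
    · exact mul_pos_of_neg_of_neg (by linarith) (by linarith)

/-- The image is a subgroup, so it suffices to reach the vectors with a single entry `-1`, which
generate because there are finitely many real embeddings. -/
theorem signs_surjective (S : Set (K →+* ℝ)) : Function.Surjective (signs S) := by
  classical
  have := finite_realEmbeddings (K := K)
  have := Fintype.ofFinite S
  rw [← MonoidHom.range_eq_top, Subgroup.eq_top_iff']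
  intro s
  rw [← Finset.univ_prod_mulSingle s]
  refine Subgroup.prod_mem _ fun ρ _ => ?_
  rcases Int.units_eq_one_or (s ρ) with h | h
  · rw [h, Pi.mulSingle_one]
    exact one_mem _
  · obtain ⟨x, hx, hx'⟩ := exists_neg_at_unique_realEmbedding ρ.1
    have hx0 : x ≠ 0 := by
      rintro rfl
      simp at hx
    refine ⟨Units.mk0 x hx0, funext fun σ => ?_⟩
    rcases eq_or_ne σ ρ with rfl | hσ
    · rw [h, Pi.mulSingle_eq_same]
      refine (Int.units_eq_one_or _).resolve_left fun h1 => ?_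
      exact hx.not_gt (signs_apply_eq_one_iff.1 h1)
    · rw [Pi.mulSingle_eq_of_ne hσ]
      exact signs_apply_eq_one_iff.2 (hx' σ.1 fun h' => hσ (Subtype.ext h'))

end Approximation

/-! ### Representatives in the order with given residue and signs -/

theorem IsOrder.finite_quotient {O : Type*} (K : Type*) [CommRing O] [IsDomain O] [CharZero O]
    [Field K] [NumberField K] [Algebra O K] [h : IsOrder O K] {m : Ideal O} (hm : m ≠ ⊥) :
    Finite (O ⧸ m) := by
  have : Module.Finite ℤ O := h.finite
  have : Module.Free ℤ O := Module.free_of_finite_type_torsion_free'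
  exact Ideal.finiteQuotientOfFreeOfNeBot m hm

/-- Lift the residue to `a₀` and take `b ∈ O` with the required signs. With `N = #(O/m) ∈ m`, the
element `a₀ + N k b` keeps the residue for every `k`, and has the signs of `b` once `k` is large. -/
theorem exists_eq_mk_and_signs_eq {O K : Type*} [CommRing O] [IsDomain O] [Field K] [NumberField K]
    [Algebra O K] [IsFractionRing O K] {m : Ideal O} [Finite (O ⧸ m)] [CharZero O] (S : Set (K →+* ℝ))
    (r : O ⧸ m) (s : S → ℤˣ) :
    ∃ (a : O) (x : Kˣ), (x : K) = algebraMap O K a ∧ Ideal.Quotient.mk m a = r ∧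
      signs S x = s := by
  have := finite_realEmbeddings (K := K)
  obtain ⟨y, rfl⟩ := signs_surjective S s
  obtain ⟨a₀, rfl⟩ := Ideal.Quotient.mk_surjective r
  obtain ⟨c, d, hd, hy⟩ := IsFractionRing.div_surjective O (y : K)
  have hd0 : algebraMap O K d ≠ 0 := IsFractionRing.to_map_ne_zero_of_mem_nonZeroDivisors hd
  -- Multiplying `y = c / d` by the square `d ^ 2` clears the denominator without changing signs.
  have hb : algebraMap O K (c * d) = y * algebraMap O K d ^ 2 := by
    rw [← hy, map_mul]
    field_simp
  have hb0 : c * d ≠ 0 := by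
    intro h0
    rw [h0, map_zero] at hb
    exact mul_ne_zero y.ne_zero (pow_ne_zero 2 hd0) hb.symm
  set b := c * d
  set N := Nat.card (O ⧸ m)
  have hN : 0 < N := Nat.card_pos
  have hNm : (N : O) ∈ m := by
    rw [← Ideal.Quotient.eq_zero_iff_mem, map_natCast, ← nsmul_one]
    exact card_nsmul_eq_zero'
  have hpos : ∀ᶠ k : ℕ in Filter.atTop, ∀ ρ : S,
      0 < ρ.1 (algebraMap O K (a₀ + N * k * b)) * ρ.1 (y : K) := by
    refine Filter.eventually_all.2 fun ρ => ?_
    have hlim : Filter.Tendsto (fun k : ℕ => ρ.1 (algebraMap O K a₀) * ρ.1 (y : K) +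
        N * (ρ.1 y * ρ.1 (algebraMap O K d)) ^ 2 * (k : ℝ)) Filter.atTop Filter.atTop := by
      refine Filter.tendsto_atTop_add_const_left _ _ ?_
      refine Filter.Tendsto.const_mul_atTop ?_ tendsto_natCast_atTop_atTop
      have h1 : ρ.1 (y : K) * ρ.1 (algebraMap O K d) ≠ 0 := by
        rw [← map_mul]
        exact (map_ne_zero _).2 (mul_ne_zero y.ne_zero hd0)
      positivity
    filter_upwards [hlim.eventually_gt_atTop 0] with k hk
    rw [map_add, map_mul, hb]
    simp only [map_add, map_mul, map_pow, map_natCast]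
    linear_combination hk
  -- The sign condition is void for empty `S`, so nonvanishing is secured separately: at most one
  -- `k` gives zero.
  have hne : ∀ᶠ k : ℕ in Filter.atTop, a₀ + N * k * b ≠ 0 := by
    rw [← Nat.cofinite_eq_atTop]
    refine Set.Subsingleton.finite fun k hk l hl => ?_
    simp only [Set.mem_compl_iff, Set.mem_ofPred_eq, not_not] at hk hl
    have h1 := add_left_cancel (hk.trans hl.symm)
    have h2 := mul_left_cancel₀ (by exact_mod_cast hN.ne') (mul_right_cancel₀ hb0 h1)
    exact_mod_cast h2
  obtain ⟨k, hk, hk0⟩ := (hpos.and hne).exists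
  have hx0 : algebraMap O K (a₀ + N * k * b) ≠ 0 := by
    rwa [Ne, IsFractionRing.to_map_eq_zero_iff]
  refine ⟨_, Units.mk0 _ hx0, rfl, ?_, signs_eq_iff.2 fun ρ hρ => hk ⟨ρ, hρ⟩⟩
  rw [Ideal.Quotient.mk_eq_mk_iff_sub_mem, add_sub_cancel_left, mul_assoc]
  exact m.mul_mem_right _ hNm

/-! ### Invertible ideals and coprimality to the modulus -/

section CoprimeIdeals

variable {O K : Type*} [CommRing O] [Field K] [Algebra O K] [IsFractionRing O K]

/-- An invertible fractional ideal is locally nonzero modulo finitely many maximal ideals: some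
nonzero element of it avoids `p J` for all `p` in a finite set of maximal ideals. -/
theorem exists_mem_forall_notMem_mul {J : FractionalIdeal O⁰ K} (hJ : IsUnit J)
    {T : Set (Ideal O)} (hT : T.Finite) (hmax : ∀ p ∈ T, p.IsMaximal) :
    ∃ x ∈ J, ∀ p ∈ T, x ∉ (p : FractionalIdeal O⁰ K) * J := by
  induction T, hT using Set.Finite.induction_on with
  | empty => exact ⟨0, FractionalIdeal.zero_mem J, by simp⟩
  | @insert p T hp hT ih =>
    obtain ⟨x, hxJ, hx⟩ := ih fun q hq => hmax q (Set.mem_insert_of_mem _ hq)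
    by_cases hxp : x ∈ (p : FractionalIdeal O⁰ K) * J
    swap
    · refine ⟨x, hxJ, ?_⟩
      rintro q (rfl | hq)
      exacts [hxp, hx q hq]
    have hpm := hmax p (Set.mem_insert _ _)
    -- If `J ≤ p J`, cancelling the invertible `J` gives `O ≤ p`.
    obtain ⟨y, hyJ, hyp⟩ : ∃ y ∈ J, y ∉ (p : FractionalIdeal O⁰ K) * J := by
      by_contra! hle
      have h1 : (1 : FractionalIdeal O⁰ K) ≤ p := by
        obtain ⟨L, hL⟩ := hJ.exists_right_inv
        rw [← hL]
        calc J * L ≤ p * J * L := mul_le_mul_left (fun y hy => hle y hy) L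
          _ = p := by rw [mul_assoc, hL, mul_one]
      rw [← FractionalIdeal.coeIdeal_top, FractionalIdeal.coeIdeal_le_coeIdeal] at h1
      exact hpm.ne_top (top_le_iff.1 h1)
    obtain ⟨e, he, hep⟩ : ∃ e, (∀ q ∈ T, e ∈ q) ∧ e ∉ p := by
      by_contra! hle
      obtain ⟨q, hq, hqp⟩ := (Ideal.IsPrime.inf_le' (s := hT.toFinset) (f := id)
        hpm.isPrime).1 fun e he => hle e fun q hq => by
          rw [Submodule.mem_finsetInf] at he
          exact he q (hT.mem_toFinset.2 hq)
      rw [hT.mem_toFinset] at hq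
      have hqm := hmax q (Set.mem_insert_of_mem _ hq)
      exact hp (hqm.eq_of_le hpm.ne_top hqp ▸ hq)
    -- Since `e` lies in every `q ∈ T` but not in `p`, adding `e • y` changes nothing modulo `q J`
    -- and leaves `p J`.
    refine ⟨x + e • y, J.val.add_mem hxJ (J.val.smul_mem e hyJ), ?_⟩
    rintro q (rfl | hq) hmem
    · have hey : e • y ∈ ((q : FractionalIdeal O⁰ K) * J).val := by
        simpa using Submodule.sub_mem _ hmem hxp
      obtain ⟨t, i, hi, hti⟩ := hpm.exists_inv hep
      refine hyp ?_
      have hy : y = t • e • y + algebraMap O K i * y := by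
        rw [← Algebra.smul_def, smul_smul, ← add_smul, hti, one_smul]
      rw [hy]
      exact Submodule.add_mem _ (Submodule.smul_mem _ t hey)
        (FractionalIdeal.mul_mem_mul (FractionalIdeal.mem_coeIdeal_of_mem _ hi) hyJ)
    · refine hx q hq ?_
      have hey : e • y ∈ ((q : FractionalIdeal O⁰ K) * J).val := by
        rw [Algebra.smul_def]
        exact FractionalIdeal.mul_mem_mul (FractionalIdeal.mem_coeIdeal_of_mem _ (he q hq)) hyJ
      have := Submodule.sub_mem _ hmem hey
      rwa [add_sub_cancel_right] at this

variable [IsDomain O]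

theorem isCoprime_of_le {R : Type*} [CommRing R] {I J m : Ideal R} (h : IsCoprime I m)
    (hIJ : I ≤ J) : IsCoprime J m := by
  rw [Ideal.isCoprime_iff_sup_eq] at h ⊢
  exact top_le_iff.1 (h ▸ sup_le_sup_right hIJ m)

theorem isCoprime_span_iff_isUnit_mk {R : Type*} [CommRing R] {m : Ideal R} {a : R} :
    IsCoprime (Ideal.span {a}) m ↔ IsUnit (Ideal.Quotient.mk m a) := by
  rw [isUnit_iff_exists_inv, Ideal.isCoprime_iff_exists]
  constructor
  · rintro ⟨i, hi, j, hj, h⟩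
    obtain ⟨t, rfl⟩ := Ideal.mem_span_singleton'.1 hi
    refine ⟨Ideal.Quotient.mk m t, ?_⟩
    rw [← map_mul, ← map_one (Ideal.Quotient.mk m), Ideal.Quotient.mk_eq_mk_iff_sub_mem, ← h]
    convert m.neg_mem hj using 1
    ring
  · rintro ⟨t, ht⟩
    obtain ⟨t, rfl⟩ := Ideal.Quotient.mk_surjective t
    rw [← map_mul, ← map_one (Ideal.Quotient.mk m), Ideal.Quotient.mk_eq_mk_iff_sub_mem] at ht
    refine ⟨t * a, Ideal.mem_span_singleton'.2 ⟨t, rfl⟩, _, m.neg_mem ht, ?_⟩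
    ring

/-- Nonzero elements of `b` congruent to `1` modulo `m` exist when `b` is coprime to `m`. -/
theorem exists_mem_ne_zero_isCoprime_span {R : Type*} [CommRing R] {b m : Ideal R}
    (hb : b ≠ ⊥) (h : IsCoprime b m) : ∃ x ∈ b, x ≠ 0 ∧ IsCoprime (Ideal.span {x}) m := by
  obtain ⟨i, hi, j, hj, hij⟩ := Ideal.isCoprime_iff_exists.1 h
  rcases eq_or_ne i 0 with rfl | hi0
  -- Here `j = 1`, so `m` is the whole ring and every element is coprime to it.
  · obtain ⟨x, hx, hx0⟩ := Submodule.exists_mem_ne_zero_of_ne_bot hb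
    refine ⟨x, hx, hx0, Ideal.isCoprime_iff_exists.2 ⟨0, zero_mem _, j, hj, hij⟩⟩
  · exact ⟨i, hi, hi0, Ideal.isCoprime_iff_exists.2
      ⟨i, Ideal.mem_span_singleton_self i, j, hj, hij⟩⟩

/-- An element generating a principal ideal in `J*_m(O)` is a quotient of elements of `O` that
are coprime to `m`. -/
theorem exists_eq_div_of_toPrincipalIdeal_mem {m : Ideal O} {x : Kˣ}
    (h : toPrincipalIdeal O K x ∈ coprimeIdeals K m) :
    ∃ a b : O, a ≠ 0 ∧ b ≠ 0 ∧ IsCoprime (Ideal.span {a}) m ∧ IsCoprime (Ideal.span {b}) m ∧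
      (x : K) = algebraMap O K a / algebraMap O K b := by
  obtain ⟨I, J, hI, hJ, hu, hx⟩ := h
  rw [eq_div_iff_mul_eq_of_isUnit hu, coe_toPrincipalIdeal] at hx
  have hJ0 : J ≠ ⊥ := by
    rintro rfl
    simp at hu
  obtain ⟨b, hbJ, hb0, hb⟩ := exists_mem_ne_zero_isCoprime_span hJ0 hJ
  have hbK : algebraMap O K b ≠ 0 := by simpa using hb0
  obtain ⟨L, hL⟩ := hu.exists_right_inv
  -- `bO = J C` with `C` integral
  have hle : FractionalIdeal.spanSingleton O⁰ (algebraMap O K b) * L ≤ 1 := by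
    rw [← hL]
    refine mul_le_mul_left ?_ L
    rw [FractionalIdeal.spanSingleton_le_iff_mem]
    exact FractionalIdeal.mem_coeIdeal_of_mem _ hbJ
  obtain ⟨C, hC⟩ := FractionalIdeal.le_one_iff_exists_coeIdeal.1 hle
  have hCJ : J * C = Ideal.span {b} := by
    refine FractionalIdeal.coeIdeal_injective (K := K) ?_
    beta_reduce
    rw [FractionalIdeal.coeIdeal_mul, hC, FractionalIdeal.coeIdeal_span_singleton,
      mul_left_comm, hL, mul_one]
  have hCm : IsCoprime C m := isCoprime_of_le hb (hCJ ▸ Ideal.mul_le_right)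
  have hIC : ((I * C : Ideal O) : FractionalIdeal O⁰ K) =
      FractionalIdeal.spanSingleton O⁰ (x * algebraMap O K b) := by
    rw [FractionalIdeal.coeIdeal_mul, ← hx, mul_assoc, ← FractionalIdeal.coeIdeal_mul, hCJ,
      FractionalIdeal.coeIdeal_span_singleton, FractionalIdeal.spanSingleton_mul_spanSingleton]
  -- The generator `x b` of the integral ideal `I C` lies in `O`; it is the numerator, coprime to
  -- `m` because `I` and `C` are.
  have hmem : (x : K) * algebraMap O K b ∈ ((I * C : Ideal O) : FractionalIdeal O⁰ K) := by
    rw [hIC]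
    exact FractionalIdeal.mem_spanSingleton_self _ _
  obtain ⟨a, -, ha⟩ := (FractionalIdeal.mem_coeIdeal _).1 hmem
  have haI : I * C = Ideal.span {a} := by
    refine FractionalIdeal.coeIdeal_injective (K := K) ?_
    beta_reduce
    rw [hIC, ← ha, FractionalIdeal.coeIdeal_span_singleton]
  refine ⟨a, b, ?_, hb0, haI ▸ hI.mul_left hCm, hb, ?_⟩
  · rintro rfl
    rw [map_zero] at ha
    exact mul_ne_zero x.ne_zero hbK ha.symm
  · rw [ha, mul_div_cancel_right₀ _ hbK]

/-- An ideal containing `m` is the preimage of its image in `R ⧸ m`, and a finite ring has finitely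
many ideals. -/
theorem finite_setOf_le {R : Type*} [CommRing R] (m : Ideal R) [Finite (R ⧸ m)] :
    {p : Ideal R | m ≤ p}.Finite := by
  refine (Set.finite_range (Ideal.comap (Ideal.Quotient.mk m))).subset fun p hp =>
    ⟨p.map (Ideal.Quotient.mk m), ?_⟩
  rw [Ideal.comap_map_of_surjective _ Ideal.Quotient.mk_surjective]
  simpa [← RingHom.ker_eq_comap_bot] using! hp

/-- Every invertible fractional ideal can be scaled into `J*_m(O)`. -/
theorem exists_toPrincipalIdeal_mul_mem_coprimeIdeals (m : Ideal O) [Finite (O ⧸ m)]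
    (I : (FractionalIdeal O⁰ K)ˣ) :
    ∃ x : Kˣ, toPrincipalIdeal O K x * I ∈ coprimeIdeals K m := by
  obtain ⟨x, hxI, hx⟩ := exists_mem_forall_notMem_mul (I⁻¹).isUnit
    ((finite_setOf_le m).inter_of_right {p | p.IsMaximal}) (fun p hp => hp.1)
  obtain ⟨x, hx0, hxI, hx⟩ : ∃ x : K, x ≠ 0 ∧ x ∈ (I⁻¹).val ∧ ∀ p : Ideal O, p.IsMaximal →
      m ≤ p → x ∉ (p : FractionalIdeal O⁰ K) * (I⁻¹).val := by
    -- Zero lies in every `p I⁻¹`, so `x = 0` can occur only if no maximal ideal contains `m`; then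
    -- any nonzero element of `I⁻¹` will do.
    rcases eq_or_ne x 0 with rfl | hx0
    · obtain ⟨y, hy0, hy⟩ := FractionalIdeal.exists_ne_zero_mem_isInteger (I⁻¹).ne_zero
      refine ⟨algebraMap O K y, by simpa using hy0, hy, fun p hp hmp => ?_⟩
      exact absurd (FractionalIdeal.zero_mem _) (hx p ⟨hp, hmp⟩)
    · exact ⟨x, hx0, hxI, fun p hp hmp => hx p ⟨hp, hmp⟩⟩
  refine ⟨Units.mk0 x hx0, ?_⟩
  have hle : FractionalIdeal.spanSingleton O⁰ x * I.val ≤ 1 := by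
    rw [← I.inv_mul]
    exact mul_le_mul_left (FractionalIdeal.spanSingleton_le_iff_mem.2 hxI) _
  obtain ⟨A, hA⟩ := FractionalIdeal.le_one_iff_exists_coeIdeal.1 hle
  refine ⟨A, 1, ?_, isCoprime_one_left, by simp, ?_⟩
  · rw [Ideal.isCoprime_iff_sup_eq]
    by_contra hne
    -- A maximal `p` containing `x I + m` would give `x ∈ p I⁻¹`, against the choice of `x`.
    obtain ⟨p, hp, hle'⟩ := Ideal.exists_le_maximal _ hne
    refine hx p hp (le_sup_right.trans hle') ?_
    rw [← FractionalIdeal.spanSingleton_le_iff_mem, ← I.mul_inv_cancel_right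
      (FractionalIdeal.spanSingleton O⁰ x), ← hA]
    exact mul_le_mul_left ((FractionalIdeal.coeIdeal_le_coeIdeal K).2 (le_sup_left.trans hle')) _
  · simp [hA]

end CoprimeIdeals

/-! ### The maps of the sequence and exactness -/

section ExactSequence

variable {O K : Type*} [CommRing O] [Field K] [Algebra O K] [IsFractionRing O K]

/-- `x O = O` only when `x` is a unit of `O`. -/
theorem exists_unit_of_toPrincipalIdeal_eq_one {x : Kˣ} (h : toPrincipalIdeal O K x = 1) :
    ∃ ε : Oˣ, Units.map (algebraMap O K : O →* K) ε = x := by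
  have hmem : ∀ y : Kˣ, toPrincipalIdeal O K y = 1 → ∃ a : O, algebraMap O K a = y := by
    intro y hy
    rw [← FractionalIdeal.mem_one_iff (S := O⁰), ← FractionalIdeal.spanSingleton_le_iff_mem,
      ← coe_toPrincipalIdeal, hy, Units.val_one]
  obtain ⟨a, ha⟩ := hmem x h
  obtain ⟨b, hb⟩ := hmem x⁻¹ (by rw [map_inv, h, inv_one])
  have hab : a * b = 1 := IsFractionRing.injective O K (by
    rw [map_mul, ha, hb, x.mul_inv, map_one])
  exact ⟨⟨a, b, hab, by rw [mul_comm, hab]⟩, Units.ext ha⟩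

theorem toPrincipalIdeal_map_unit (ε : Oˣ) :
    toPrincipalIdeal O K (Units.map (algebraMap O K : O →* K) ε) = 1 := by
  rw [toPrincipalIdeal_eq_iff, Units.coe_map, MonoidHom.coe_coe,
    ← FractionalIdeal.coeIdeal_span_singleton, Ideal.span_singleton_eq_top.2 ε.isUnit,
    FractionalIdeal.coeIdeal_top, Units.val_one]

variable [IsDomain O]

theorem toPrincipalIdeal_mem_coprimeIdeals_of_isUnit {m : Ideal O} {a : O} {x : Kˣ}
    (hx : (x : K) = algebraMap O K a) (ha : IsUnit (Ideal.Quotient.mk m a)) :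
    toPrincipalIdeal O K x ∈ coprimeIdeals K m :=
  toPrincipalIdeal_mem_coprimeIdeals one_ne_zero (isCoprime_span_iff_isUnit_mk.2 ha)
    (isCoprime_span_iff_isUnit_mk.2 (by simp)) (by simpa using hx)

theorem rayClass_eq_iff {m : Ideal O} {S : Set (K →+* ℝ)} {I J : coprimeIdeals K m} :
    rayClass m S I = rayClass m S J ↔
      ∃ z ∈ raySubgroup m S, toPrincipalIdeal O K z * I = J := by
  refine QuotientGroup.eq.trans (Subgroup.mem_subgroupOf.trans (Subgroup.mem_map.trans ?_))
  refine exists_congr fun z => and_congr_right fun _ => ?_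
  rw [Subgroup.coe_mul, Subgroup.coe_inv, eq_inv_mul_iff_mul_eq, mul_comm]

/-- This is what makes the class of `a O` depend only on the residue and signs of `a`. -/
theorem div_mem_raySubgroup {m : Ideal O} {S : Set (K →+* ℝ)} {a b : O} {x y : Kˣ}
    (hx : (x : K) = algebraMap O K a) (hy : (y : K) = algebraMap O K b)
    (hb : IsUnit (Ideal.Quotient.mk m b)) (hab : Ideal.Quotient.mk m a = Ideal.Quotient.mk m b)
    (hs : signs S x = signs S y) : x / y ∈ raySubgroup m S := by
  refine ⟨congr_one_iff.2 ⟨a, b, ?_, isCoprime_span_iff_isUnit_mk.2 hb, ?_,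
    Ideal.Quotient.eq.1 hab⟩, fun ρ hρ => ?_⟩
  · rintro rfl
    exact y.ne_zero (by rw [hy, map_zero])
  · rw [Units.val_div_eq_div_val, hx, hy]
  · refine (signs_apply_eq_one_iff (S := S) (ρ := ⟨ρ, hρ⟩)).1 ?_
    rw [map_div, hs, div_self', Pi.one_apply]

/-- The homomorphism `(O/m)ˣ × {±1}^S → Cl_{m,S}(O)` exists as soon as every element of its
domain comes from an element of `O`. -/
theorem exists_hom_rayClassGroup {m : Ideal O} {S : Set (K →+* ℝ)}
    (hrep : ∀ (r : O ⧸ m) (s : S → ℤˣ), ∃ (a : O) (x : Kˣ), (x : K) = algebraMap O K a ∧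
      Ideal.Quotient.mk m a = r ∧ signs S x = s) :
    ∃ g : (O ⧸ m)ˣ × (S → ℤˣ) →* RayClassGroup m S,
      ∀ (a : O) (x : Kˣ) (u : (O ⧸ m)ˣ) (I : coprimeIdeals K m),
        (x : K) = algebraMap O K a → (u : O ⧸ m) = Ideal.Quotient.mk m a →
        (I : (FractionalIdeal O⁰ K)ˣ) = toPrincipalIdeal O K x →
        g (u, signs S x) = rayClass m S I := by
  choose a x hx ha hs using hrep
  let J : (O ⧸ m)ˣ × (S → ℤˣ) → coprimeIdeals K m := fun y =>
    ⟨toPrincipalIdeal O K (x y.1 y.2),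
      toPrincipalIdeal_mem_coprimeIdeals_of_isUnit (hx _ _) (by rw [ha]; exact y.1.isUnit)⟩
  have key : ∀ (b : O) (z : Kˣ) (u : (O ⧸ m)ˣ) (I : coprimeIdeals K m),
      (z : K) = algebraMap O K b → (u : O ⧸ m) = Ideal.Quotient.mk m b →
      (I : (FractionalIdeal O⁰ K)ˣ) = toPrincipalIdeal O K z →
      rayClass m S (J (u, signs S z)) = rayClass m S I := by
    intro b z u I hz hu hI
    refine rayClass_eq_iff.2 ⟨z / x u (signs S z),
      div_mem_raySubgroup hz (hx _ _) (by rw [ha]; exact u.isUnit) (hu.symm.trans (ha _ _).symm)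
        (hs _ _).symm, ?_⟩
    rw [hI, ← map_mul, div_mul_cancel]
  refine ⟨MonoidHom.mk' (fun y => rayClass m S (J y)) fun y z => ?_, key⟩
  rw [← map_mul]
  -- The product of the chosen representatives need not be the one chosen for the product, but it
  -- has the right residue and signs, so `key` applies.
  have := key (a y.1 y.2 * a z.1 z.2) (x y.1 y.2 * x z.1 z.2) (y.1 * z.1) (J y * J z)
    (by rw [Units.val_mul, hx, hx, map_mul]) (by rw [Units.val_mul, map_mul, ha, ha])
    (by rw [map_mul]; rfl)
  rwa [map_mul, hs, hs] at this

theorem rayUnits_eq_ker_unitMap (m : Ideal O) (S : Set (K →+* ℝ)) :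
    rayUnits m S = (unitMap m S).ker := by
  refine le_antisymm (rayUnits_le_ker_unitMap m S) fun ε hε => ?_
  obtain ⟨h1, h2⟩ := Prod.ext_iff.1 (MonoidHom.mem_ker.1 hε)
  exact ⟨Ideal.Quotient.eq.1 (congrArg Units.val h1), fun ρ hρ =>
    (signUnit_eq_one_iff _).1 (congrFun h2 ⟨ρ, hρ⟩)⟩

theorem unitQuotientMap_injective (m : Ideal O) (S : Set (K →+* ℝ)) :
    Function.Injective (unitQuotientMap m S) := by
  rw [injective_iff_map_eq_one]
  intro q hq
  induction q using QuotientGroup.induction_on with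
  | H ε =>
    rw [QuotientGroup.eq_one_iff, rayUnits_eq_ker_unitMap]
    exact hq

theorem range_unitQuotientMap (m : Ideal O) (S : Set (K →+* ℝ)) :
    Set.range (unitQuotientMap m S) = (unitMap m S).range := by
  ext y
  constructor
  · rintro ⟨q, rfl⟩
    induction q using QuotientGroup.induction_on with
    | H ε => exact ⟨ε, rfl⟩
  · rintro ⟨ε, rfl⟩
    exact ⟨QuotientGroup.mk ε, rfl⟩

theorem ker_eq_range_unitMap {m : Ideal O} {S : Set (K →+* ℝ)}
    (hrep : ∀ (r : O ⧸ m) (s : S → ℤˣ), ∃ (a : O) (x : Kˣ), (x : K) = algebraMap O K a ∧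
      Ideal.Quotient.mk m a = r ∧ signs S x = s)
    {g : (O ⧸ m)ˣ × (S → ℤˣ) →* RayClassGroup m S}
    (hg : ∀ (a : O) (x : Kˣ) (u : (O ⧸ m)ˣ) (I : coprimeIdeals K m),
        (x : K) = algebraMap O K a → (u : O ⧸ m) = Ideal.Quotient.mk m a →
        (I : (FractionalIdeal O⁰ K)ˣ) = toPrincipalIdeal O K x →
        g (u, signs S x) = rayClass m S I) :
    g.ker = (unitMap m S).range := by
  ext ⟨u, s⟩
  rw [MonoidHom.mem_ker]
  constructor
  · intro h
    obtain ⟨a, x, hx, ha, rfl⟩ := hrep u s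
    have hI := toPrincipalIdeal_mem_coprimeIdeals_of_isUnit hx (ha ▸ u.isUnit)
    rw [hg a x u ⟨_, hI⟩ hx ha.symm rfl, ← map_one (rayClass m S), eq_comm,
      rayClass_eq_iff] at h
    obtain ⟨z, ⟨hz, hpos⟩, hzx⟩ := h
    rw [Subgroup.coe_one, mul_one] at hzx
    obtain ⟨c, d, hd0, hd, hzcd, hcd⟩ := congr_one_iff.1 hz
    obtain ⟨ε, hε⟩ := exists_unit_of_toPrincipalIdeal_eq_one (O := O) (x := x / z) (by
      rw [map_div, hzx, div_self'])
    have hxz : x = Units.map (algebraMap O K : O →* K) ε * z := by rw [hε, div_mul_cancel]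
    refine ⟨ε, Prod.ext (Units.ext ?_) ?_⟩
    · change Ideal.Quotient.mk m ε = u
      have hd0' : algebraMap O K d ≠ 0 := by simpa using hd0
      -- From `a = ε c / d` in `K`. Modulo `m`, `c` and `d` agree and are units, so cancelling gives
      -- `a ≡ ε`.
      have had : a * d = ε * c := IsFractionRing.injective O K (by
        have := congrArg Units.val hxz
        rw [Units.val_mul, hzcd, hx, mul_div_assoc', eq_div_iff hd0'] at this
        simpa using this)
      have := congrArg (Ideal.Quotient.mk m) had
      rw [map_mul, map_mul, Ideal.Quotient.eq.2 hcd] at this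
      rw [← ha]
      exact ((isCoprime_span_iff_isUnit_mk.1 hd).mul_right_cancel this).symm
    · change signs S (Units.map (algebraMap O K : O →* K) ε) = signs S x
      have hz1 : signs S z = 1 := funext fun ρ => signs_apply_eq_one_iff.2 (hpos ρ.1 ρ.2)
      rw [hxz, map_mul, hz1, mul_one]
  · rintro ⟨ε, hε⟩
    rw [← hε]
    exact (hg ε (Units.map (algebraMap O K : O →* K) ε) _ 1 rfl rfl
      (toPrincipalIdeal_map_unit ε).symm).trans (map_one _)

theorem classGroupMk_eq_one_iff {I : (FractionalIdeal O⁰ K)ˣ} :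
    ClassGroup.mk K I = 1 ↔ ∃ x : Kˣ, toPrincipalIdeal O K x = I := by
  rw [ClassGroup.mk_eq_one_iff, FractionalIdeal.isPrincipal_iff]
  constructor
  · rintro ⟨x, hx⟩
    have hx0 : x ≠ 0 := by
      rintro rfl
      exact I.ne_zero (by rw [hx, FractionalIdeal.spanSingleton_zero])
    exact ⟨Units.mk0 x hx0, toPrincipalIdeal_eq_iff.2 hx.symm⟩
  · rintro ⟨x, rfl⟩
    exact ⟨x, coe_toPrincipalIdeal x⟩

theorem toClassGroup_rayClass {m : Ideal O} {S : Set (K →+* ℝ)} (I : coprimeIdeals K m) :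
    toClassGroup m S (rayClass m S I) = ClassGroup.mk K I.1 :=
  rfl

/-- A class in the kernel is that of some `x O` with `x = a / b` and `a`, `b` coprime to `m`, hence
the quotient of the images under `g` of the data of `a` and `b`. -/
theorem ker_toClassGroup_eq_range {m : Ideal O} {S : Set (K →+* ℝ)}
    (hrep : ∀ (r : O ⧸ m) (s : S → ℤˣ), ∃ (a : O) (x : Kˣ), (x : K) = algebraMap O K a ∧
      Ideal.Quotient.mk m a = r ∧ signs S x = s)
    {g : (O ⧸ m)ˣ × (S → ℤˣ) →* RayClassGroup m S}
    (hg : ∀ (a : O) (x : Kˣ) (u : (O ⧸ m)ˣ) (I : coprimeIdeals K m),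
        (x : K) = algebraMap O K a → (u : O ⧸ m) = Ideal.Quotient.mk m a →
        (I : (FractionalIdeal O⁰ K)ˣ) = toPrincipalIdeal O K x →
        g (u, signs S x) = rayClass m S I) :
    (toClassGroup m S).ker = g.range := by
  ext c
  rw [MonoidHom.mem_ker, MonoidHom.mem_range]
  constructor
  · obtain ⟨I, rfl⟩ := QuotientGroup.mk'_surjective _ c
    intro h
    obtain ⟨x, hx⟩ := classGroupMk_eq_one_iff.1 ((toClassGroup_rayClass I).symm.trans h)
    obtain ⟨a, b, ha0, hb0, ha, hb, hxab⟩ :=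
      exists_eq_div_of_toPrincipalIdeal_mem (hx ▸ I.2 : toPrincipalIdeal O K x ∈ _)
    rw [isCoprime_span_iff_isUnit_mk] at ha hb
    let xa : Kˣ := Units.mk0 (algebraMap O K a) (by simpa using ha0)
    let xb : Kˣ := Units.mk0 (algebraMap O K b) (by simpa using hb0)
    have hxx : x = xa / xb := Units.ext (by rw [Units.val_div_eq_div_val]; exact hxab)
    refine ⟨(ha.unit, signs S xa) / (hb.unit, signs S xb), ?_⟩
    rw [map_div, hg a xa ha.unit ⟨_, toPrincipalIdeal_mem_coprimeIdeals_of_isUnit rfl ha⟩ rfl rfl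
      rfl, hg b xb hb.unit ⟨_, toPrincipalIdeal_mem_coprimeIdeals_of_isUnit rfl hb⟩ rfl rfl rfl,
      ← map_div]
    refine congrArg (rayClass m S) (Subtype.ext ?_)
    rw [← hx, hxx, map_div]
    rfl
  · rintro ⟨⟨u, s⟩, rfl⟩
    obtain ⟨a, x, hx, ha, rfl⟩ := hrep u s
    rw [hg a x u ⟨_, toPrincipalIdeal_mem_coprimeIdeals_of_isUnit hx (ha ▸ u.isUnit)⟩ hx ha.symm
      rfl, toClassGroup_rayClass]
    exact classGroupMk_eq_one_iff.2 ⟨x, rfl⟩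

theorem toClassGroup_surjective (m : Ideal O) [Finite (O ⧸ m)] (S : Set (K →+* ℝ)) :
    Function.Surjective (toClassGroup m S) := by
  refine ClassGroup.induction K fun I => ?_
  obtain ⟨x, hx⟩ := exists_toPrincipalIdeal_mul_mem_coprimeIdeals m I
  refine ⟨rayClass m S ⟨_, hx⟩, ?_⟩
  rw [toClassGroup_rayClass, map_mul, classGroupMk_eq_one_iff.2 ⟨x, rfl⟩, one_mul]

end ExactSequence

end RayClass

theorem corollary5p4 {O K : Type*} [CommRing O] [IsDomain O] [Field K] [NumberField K]
    [Algebra O K] [RayClass.IsOrder O K] (m : Ideal O) (hm : m ≠ ⊥) (S : Set (K →+* ℝ)) :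
    ∃ g : (O ⧸ m)ˣ × (S → ℤˣ) →* RayClass.RayClassGroup m S,
      -- `g` sends the pair `(a mod m, signs of a)` to the class of the principal ideal `a O`
      (∀ (a : O) (x : Kˣ) (u : (O ⧸ m)ˣ) (I : RayClass.coprimeIdeals K m),
        (x : K) = algebraMap O K a → (u : O ⧸ m) = Ideal.Quotient.mk m a →
        (I : (FractionalIdeal (nonZeroDivisors O) K)ˣ) = toPrincipalIdeal O K x →
        g (u, RayClass.signs S x) = RayClass.rayClass m S I) ∧
      Function.Injective (RayClass.unitQuotientMap m S) ∧
      Function.MulExact (RayClass.unitQuotientMap m S) g ∧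
      Function.MulExact g (RayClass.toClassGroup m S) ∧
      Function.Surjective (RayClass.toClassGroup m S) ∧
      -- the kernel is `(O/m)ˣ × {±1}^S` modulo the image of the units, via `g`
      ∃ e : ((O ⧸ m)ˣ × (S → ℤˣ)) ⧸ (RayClass.unitMap m S).range ≃*
          (RayClass.toClassGroup m S).ker,
        ∀ y : (O ⧸ m)ˣ × (S → ℤˣ),
          ((e (QuotientGroup.mk y) : (RayClass.toClassGroup m S).ker) :
            RayClass.RayClassGroup m S) = g y := by
  have : CharZero O := (algebraMap O K).charZero
  have := RayClass.IsOrder.finite_quotient K hm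
  have hrep := RayClass.exists_eq_mk_and_signs_eq (m := m) S
  obtain ⟨g, hg⟩ := RayClass.exists_hom_rayClassGroup hrep
  have hker := RayClass.ker_eq_range_unitMap hrep hg
  have hrange := RayClass.ker_toClassGroup_eq_range hrep hg
  refine ⟨g, hg, RayClass.unitQuotientMap_injective m S, fun y => ?_, fun c => ?_,
    RayClass.toClassGroup_surjective m S,
    -- The first isomorphism theorem for `g`, with its kernel and range rewritten by exactness.
    (QuotientGroup.quotientMulEquivOfEq hker.symm).trans
      ((QuotientGroup.quotientKerEquivRange g).trans (MulEquiv.subgroupCongr hrange.symm)),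
    fun y => rfl⟩
  · rw [← MonoidHom.mem_ker, hker, RayClass.range_unitQuotientMap, SetLike.mem_coe]
  · rw [← MonoidHom.mem_ker, hrange, MonoidHom.mem_range, Set.mem_range]
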